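/- Call a real square matrix a $P$-matrix if all its principal minors are positive, a $Z$-matrix if all its off-diagonal entries are non-positive, and a $K$-matrix if it is both. A matrix $M\in\mathbb{R}^{mn\times mn}$, partitioned into blocks $M_{ij}\in\mathbb{R}^{m\times m}$ ($1\le i,j\le n$), is a block triangular $K$-matrix if either $M_{ij}=0$ for all $i<j$ and $M_{ij}$ is a $K$-matrix for all $i\ge j$, or $M_{ij}=0$ for all $i>j$ and $M_{ij}$ is a $K$-matrix for all $i\le j$. For $q\in\mathbb{R}^{mn}$, $\mathrm{LCP}(M,q)$ is the problem of finding $z\ge 0$ with $q+Mz\ge 0$ and $z^T(q+Mz)=0$. Theorem. Let $M$ be a block triangular $K$-matrix. Then $M$ is a $P$-matrix, and for every $q\in\mathbb{R}^{mn}$ the problem $\mathrm{LCP}(M,q)$ is processable by Lemke's algorithm: for every covering vector $d>0$, Lemke's complementary pivot algorithm applied to $w-Mz-z_0d=q$, $w,z,z_0\ge 0$ (with the lexicographic minimum ratio rule to resolve ties) stops after finitely many pivots, either with a solution of $\mathrm{LCP}(M,q)$, or on a secondary ray, in which case $\mathrm{LCP}(M,q)$ has no solution. -/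

import Mathlib

/-! ### Matrix classes -/

/-- `P`-matrix: every principal minor is positive. -/
def IsPMatrix {ι : Type*} [Fintype ι] [DecidableEq ι] (M : Matrix ι ι ℝ) : Prop :=
  ∀ α : Finset ι, 0 < (M.submatrix (fun i : α => (i : ι)) (fun i : α => (i : ι))).det

/-- `Z`-matrix: the off-diagonal entries are non-positive. -/
def IsZMatrix {ι : Type*} (M : Matrix ι ι ℝ) : Prop :=
  ∀ i j, i ≠ j → M i j ≤ 0

/-- `K`-matrix: a `Z`-matrix that is also a `P`-matrix. -/
def IsKMatrix {ι : Type*} [Fintype ι] [DecidableEq ι] (M : Matrix ι ι ℝ) : Prop :=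
  IsZMatrix M ∧ IsPMatrix M

/-- The `m × m` block `M_{ij}` of a matrix of order `n * m`, cut into `n × n` consecutive blocks:
entry `(a, b)` of the block is the entry of `M` in row `i * m + a` and column `j * m + b`. -/
def matrixBlock {n m : ℕ} (M : Matrix (Fin (n * m)) (Fin (n * m)) ℝ) (i j : Fin n) :
    Matrix (Fin m) (Fin m) ℝ :=
  Matrix.of fun a b => M (finProdFinEquiv (i, a)) (finProdFinEquiv (j, b))

/-- Block triangular `K`-matrix: the blocks on one side of the block diagonal vanish, and all the
others, those on the block diagonal included, are `K`-matrices. -/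
def IsBlockTriangularK (n m : ℕ) (M : Matrix (Fin (n * m)) (Fin (n * m)) ℝ) : Prop :=
  (∀ i j : Fin n, (i < j → matrixBlock M i j = 0) ∧ (j ≤ i → IsKMatrix (matrixBlock M i j))) ∨
  (∀ i j : Fin n, (j < i → matrixBlock M i j = 0) ∧ (i ≤ j → IsKMatrix (matrixBlock M i j)))

/-! ### The linear complementarity problem -/

/-- `FEA(M, q)`. -/
def lcpFeasible {N : ℕ} (M : Matrix (Fin N) (Fin N) ℝ) (q : Fin N → ℝ) : Set (Fin N → ℝ) :=
  {z | 0 ≤ z ∧ 0 ≤ q + M.mulVec z}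

/-- `SOL(M, q)`. -/
def lcpSolutions {N : ℕ} (M : Matrix (Fin N) (Fin N) ℝ) (q : Fin N → ℝ) : Set (Fin N → ℝ) :=
  {z | z ∈ lcpFeasible M q ∧ dotProduct z (q + M.mulVec z) = 0}

/-! ### Lemke's algorithm

The algorithm works with the augmented system `w - M z - z₀ d = q`, `w, z, z₀ ≥ 0`, where `d > 0` is
the covering vector. Ties are broken by the lexicographic rule, the standard safeguard against
cycling; for a nondegenerate problem there are no ties. -/

/-- The variables of the augmented system. -/
inductive LemkeVar (N : ℕ) : Type
  | w (i : Fin N)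
  | z (i : Fin N)
  | z0
  deriving DecidableEq

/-- The column of a variable in the augmented system `w - M z - z₀ d = q`. -/
def lemkeColumn {N : ℕ} (M : Matrix (Fin N) (Fin N) ℝ) (d : Fin N → ℝ) :
    LemkeVar N → Fin N → ℝ
  | .w i => Pi.single i 1
  | .z i => fun k => -M k i
  | .z0 => -d

/-- The basis matrix; `B r` is the variable that is basic in row `r`. -/
def lemkeBasisMatrix {N : ℕ} (M : Matrix (Fin N) (Fin N) ℝ) (d : Fin N → ℝ)
    (B : Fin N → LemkeVar N) : Matrix (Fin N) (Fin N) ℝ :=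
  Matrix.of fun k r => lemkeColumn M d (B r) k

/-- The values of the basic variables. -/
noncomputable def lemkeBasicValues {N : ℕ} (M : Matrix (Fin N) (Fin N) ℝ) (q d : Fin N → ℝ)
    (B : Fin N → LemkeVar N) : Fin N → ℝ :=
  (lemkeBasisMatrix M d B)⁻¹.mulVec q

/-- The `z`-part of the basic solution: nonbasic variables are zero. -/
noncomputable def lemkeZPart {N : ℕ} (M : Matrix (Fin N) (Fin N) ℝ) (q d : Fin N → ℝ)
    (B : Fin N → LemkeVar N) : Fin N → ℝ :=
  fun i => ∑ r, if B r = LemkeVar.z i then lemkeBasicValues M q d B r else 0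

/-- The column of the variable `e` in the current tableau: when `e` is raised from zero to `t`,
the basic variable of row `r` decreases by `t` times the entry `r`. -/
noncomputable def lemkeDrivingColumn {N : ℕ} (M : Matrix (Fin N) (Fin N) ℝ) (d : Fin N → ℝ)
    (B : Fin N → LemkeVar N) (e : LemkeVar N) : Fin N → ℝ :=
  (lemkeBasisMatrix M d B)⁻¹.mulVec (lemkeColumn M d e)

/-- The vector `(x, v) / c`, to be compared lexicographically. -/
noncomputable def lexRatio {N : ℕ} (x : ℝ) (v : Fin N → ℝ) (c : ℝ) :
    Lex (Fin (N + 1) → ℝ) :=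
  toLex (fun k => (Fin.cons x v : Fin (N + 1) → ℝ) k / c)

/-- An index of `S` that minimizes `key`, and `none` if `S` is empty. -/
noncomputable def argminIn {N : ℕ} (S : Finset (Fin N)) (key : Fin N → Lex (Fin (N + 1) → ℝ)) :
    Option (Fin N) :=
  open Classical in
  if h : S.Nonempty then some (S.exists_min_image key h).choose else none

/-- Lexicographic minimum ratio test: among the rows whose entry in the driving column is positive,
the row for which (basic value, row of the inverse basis matrix) divided by this entry is
lexicographically least; `none` if the driving variable is not blocked. -/
noncomputable def lemkeBlockingRow {N : ℕ} (M : Matrix (Fin N) (Fin N) ℝ) (q d : Fin N → ℝ)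
    (B : Fin N → LemkeVar N) (e : LemkeVar N) : Option (Fin N) :=
  open Classical in
  argminIn (Finset.univ.filter fun r => 0 < lemkeDrivingColumn M d B e r)
    (fun r => lexRatio (lemkeBasicValues M q d B r) ((lemkeBasisMatrix M d B)⁻¹ r)
      (lemkeDrivingColumn M d B e r))

/-- States of the algorithm: a basis with the driving variable that is about to enter it,
termination with a vector `z`, or termination on a secondary ray. -/
inductive LemkeState (N : ℕ) : Type
  | pivoting (B : Fin N → LemkeVar N) (e : LemkeVar N)
  | stopped (z : Fin N → ℝ)
  | ray

/-- Initialization. If `q ≥ 0`, stop with `z = 0`. Otherwise `z₀` enters the basis of all `w_i` in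
the row `r` in which `(q_r, e_r) / d_r` is lexicographically least, and the complement `z_r` of the
leaving variable `w_r` becomes the driving variable. -/
noncomputable def lemkeInit {N : ℕ} (q d : Fin N → ℝ) : LemkeState N :=
  open Classical in
  if 0 ≤ q then .stopped 0
  else
    match argminIn Finset.univ (fun i => lexRatio (q i) (Pi.single i 1) (d i)) with
    | none => .stopped 0
    | some r => .pivoting (Function.update LemkeVar.w r LemkeVar.z0) (.z r)

/-- One pivot. If the driving variable is not blocked, stop on a ray. Otherwise it replaces the
blocking variable; stop if that was `z₀`, and else the complement of the blocking variable becomes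
the driving variable. -/
noncomputable def lemkeStep {N : ℕ} (M : Matrix (Fin N) (Fin N) ℝ) (q d : Fin N → ℝ) :
    LemkeState N → LemkeState N
  | .pivoting B e =>
    match lemkeBlockingRow M q d B e with
    | none => .ray
    | some r =>
      match B r with
      | .z0 => .stopped (lemkeZPart M q d (Function.update B r e))
      | .w i => .pivoting (Function.update B r e) (.z i)
      | .z i => .pivoting (Function.update B r e) (.w i)
  | s => s

/-- `LCP(M, q)` is processable by Lemke's algorithm: for every covering vector `d > 0`, the
algorithm stops after finitely many pivots, either with a solution of `LCP(M, q)`, or on a secondary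
ray, and then `LCP(M, q)` has no solution. -/
def IsLemkeProcessable {N : ℕ} (M : Matrix (Fin N) (Fin N) ℝ) (q : Fin N → ℝ) : Prop :=
  ∀ d : Fin N → ℝ, (∀ i, 0 < d i) →
    ∃ k : ℕ,
      (∃ z, (lemkeStep M q d)^[k] (lemkeInit q d) = .stopped z ∧ z ∈ lcpSolutions M q) ∨
      ((lemkeStep M q d)^[k] (lemkeInit q d) = .ray ∧ lcpSolutions M q = ∅)

/-! ### `P`-matrices -/

/-! A principal submatrix of a block triangular matrix is block triangular, and its determinant is a
product of principal minors of the diagonal blocks. Those blocks are `P`-matrices, so `M` is one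
(`isPMatrix_of_blockTriangular`).

For a `P`-matrix Lemke's algorithm never meets a ray. Since `M` reverses the sign of no nonzero
vector, the columns of `w i` and `z i` have entries of opposite signs in the row of `z₀`, unless
both vanish (`IsPMatrix.lemkeDrivingColumn_mul_neg`). After a pivot that lowers `z₀`, raising the
variable that has just left would raise `z₀` again, so raising its complement, the next driving
variable, lowers `z₀`. The row of `z₀` therefore always competes in the ratio test, and some
variable blocks.

Under the lexicographic rule the `z₀`-row of `B⁻¹ [q, I]` strictly decreases while `z₀` stays basic.
There are finitely many bases, so `z₀` eventually leaves, and the complementary feasible basis that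
remains gives a solution. -/

theorem IsPMatrix.det_submatrix_pos {ι κ : Type*} [Fintype ι] [DecidableEq ι] [Fintype κ]
    [DecidableEq κ] {M : Matrix ι ι ℝ} (hM : IsPMatrix M) {f : κ → ι}
    (hf : Function.Injective f) : 0 < (M.submatrix f f).det := by
  let e : κ ≃ (Finset.univ.image f : Finset ι) :=
    Equiv.ofBijective (fun k => ⟨f k, Finset.mem_image_of_mem f (Finset.mem_univ k)⟩)
      ⟨fun a b h => hf (congrArg Subtype.val h), fun ⟨i, hi⟩ => by
        obtain ⟨k, -, hk⟩ := Finset.mem_image.1 hi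
        exact ⟨k, Subtype.ext hk⟩⟩
  have h := hM (Finset.univ.image f)
  rw [← Matrix.det_submatrix_equiv_self e] at h
  exact h

/-- Expansion of `det (A + diagonal D)` along the rows, the rows of `A` vanishing outside `α`. -/
theorem IsPMatrix.det_piecewise_pos {ι : Type*} [Fintype ι] [DecidableEq ι] {M : Matrix ι ι ℝ}
    (hM : IsPMatrix M) (α : Finset ι) {D : ι → ℝ} (hD : ∀ i, 0 ≤ D i)
    (hD' : ∀ i, i ∉ α → D i = 1) :
    0 < (Matrix.of (fun i j => if i ∈ α then M i j else 0) + Matrix.diagonal D).det := by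
  let A : Matrix ι ι ℝ := Matrix.of fun i j => if i ∈ α then M i j else 0
  let C : Finset ι → Matrix ι ι ℝ := fun s =>
    Matrix.of fun i j => if i ∈ s then A i j else Matrix.diagonal D i j
  -- The term of the expansion with rows `s` from `A` and the others from `diagonal D` is block
  -- triangular: a principal minor of `M` times a product of entries of `D`.
  have key : ∀ s : Finset ι, s ⊆ α → ∃ c : ℝ, 0 < c ∧
      (C s).det = c * ∏ i : {i // i ∉ s}, D i := by
    intro s hs
    refine ⟨_, hM.det_submatrix_pos (Subtype.val_injective (p := fun i => i ∈ s)), ?_⟩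
    rw [Matrix.twoBlockTriangular_det _ (fun i => i ∈ s)]
    · have h₁ : (C s).toSquareBlockProp (fun i => i ∈ s) =
          M.submatrix Subtype.val Subtype.val := by
        ext ⟨i, hi⟩ ⟨j, hj⟩
        simp [Matrix.toSquareBlockProp, C, A, hi, hs hi]
      have h₂ : (C s).toSquareBlockProp (fun i => i ∉ s) =
          Matrix.diagonal fun i : {i // i ∉ s} => D i := by
        ext ⟨i, hi⟩ ⟨j, hj⟩
        simp [Matrix.toSquareBlockProp, C, hi, Matrix.diagonal_apply]
      rw [h₁, h₂, Matrix.det_diagonal]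
      congr!
    · intro i hi j hj
      have : i ≠ j := by rintro rfl; exact hi hj
      simp [C, hi, Matrix.diagonal_apply, this]
  have hexp : (A + Matrix.diagonal D).det = ∑ s : Finset ι, (C s).det := by
    refine (MultilinearMap.map_add_univ
      (Matrix.detRowAlternating (n := ι) (R := ℝ)).toMultilinearMap A
      (Matrix.diagonal D)).trans (Finset.sum_congr rfl fun s _ => ?_)
    refine congrArg Matrix.det (?_ : _ = C s)
    funext i j
    by_cases hi : i ∈ s <;> simp [C, hi, Finset.piecewise]
  change 0 < (A + Matrix.diagonal D).det
  rw [hexp]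
  -- The term `s = α` is positive because `D` is `1` off `α`; if `s` is not contained in `α`, a row
  -- of `A` vanishes.
  refine Finset.sum_pos' (fun s _ => ?_) ⟨α, Finset.mem_univ _, ?_⟩
  · by_cases hs : s ⊆ α
    · obtain ⟨c, hc, h⟩ := key s hs
      rw [h]
      exact mul_nonneg hc.le (Finset.prod_nonneg fun i _ => hD i)
    · obtain ⟨i, his, hiα⟩ := Finset.not_subset.1 hs
      refine (Matrix.det_eq_zero_of_row_eq_zero i fun j => ?_).ge
      simp [C, A, his, hiα]
  · obtain ⟨c, hc, h⟩ := key α subset_rfl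
    rw [h]
    refine mul_pos hc (Finset.prod_pos fun i _ => ?_)
    rw [hD' i i.2]
    exact one_pos

/-- A `P`-matrix reverses the sign of no nonzero vector. -/
theorem IsPMatrix.exists_mul_mulVec_pos {ι : Type*} [Fintype ι] [DecidableEq ι]
    {M : Matrix ι ι ℝ} (hM : IsPMatrix M) {x : ι → ℝ} (hx : x ≠ 0) :
    ∃ i, 0 < x i * M.mulVec x i := by
  by_contra! hcon
  let α : Finset ι := Finset.univ.filter fun i => x i ≠ 0
  have hα : ∀ i, i ∈ α ↔ x i ≠ 0 := fun i => by simp [α]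
  -- On the support of `x` this is `-(M x) i / x i`, chosen so that `x` lies in the kernel of the
  -- matrix with positive determinant.
  let D : ι → ℝ := fun i => if i ∈ α then -(x i * M.mulVec x i) / (x i) ^ 2 else 1
  have hpos := hM.det_piecewise_pos α (D := D)
    (fun i => by
      by_cases hi : i ∈ α
      · simp only [D, hi, if_true]
        exact div_nonneg (neg_nonneg.2 (hcon i)) (sq_nonneg _)
      · simp [D, hi])
    (fun i hi => by simp [D, hi])
  refine hpos.ne' (Matrix.exists_mulVec_eq_zero_iff.1 ⟨x, hx, ?_⟩)
  ext i
  rw [Matrix.add_mulVec, Pi.add_apply, Matrix.mulVec_diagonal]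
  by_cases hi : i ∈ α
  · have hxi := (hα i).1 hi
    have : (Matrix.of (fun i j => if i ∈ α then M i j else 0) : Matrix ι ι ℝ).mulVec x i =
        M.mulVec x i := by simp [Matrix.mulVec, dotProduct, hi]
    rw [this]
    simp only [D, hi, if_true, Pi.zero_apply]
    field_simp
    ring
  · have hxi : x i = 0 := by simpa using mt (hα i).2 hi
    simp [Matrix.mulVec, dotProduct, hi, hxi]

/-! ### Block triangular `K`-matrices are `P`-matrices -/

/-- A matrix that is block triangular with respect to an assignment `b` of the indices to the
blocks is a `P`-matrix as soon as its diagonal blocks have positive principal minors. -/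
theorem isPMatrix_of_blockTriangular {ι β : Type*} [Fintype ι] [DecidableEq ι] [LinearOrder β]
    {M : Matrix ι ι ℝ} {b : ι → β} (hb : M.BlockTriangular b)
    (hd : ∀ (k : β) (α : Finset ι), (∀ i ∈ α, b i = k) →
      0 < (M.submatrix (fun i : α => (i : ι)) (fun i : α => (i : ι))).det) :
    IsPMatrix M := by
  intro α
  have hbα : (M.submatrix (fun i : α => (i : ι)) (fun i : α => (i : ι))).BlockTriangular
      (fun i : α => b i) := fun i j hij => hb hij
  rw [hbα.det]
  refine Finset.prod_pos fun k _ => ?_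
  let e : {i : α // b i = k} ≃ (α.filter fun i => b i = k : Finset ι) :=
    { toFun := fun i => ⟨i.1.1, Finset.mem_filter.2 ⟨i.1.2, i.2⟩⟩
      invFun := fun i => ⟨⟨i.1, (Finset.mem_filter.1 i.2).1⟩, (Finset.mem_filter.1 i.2).2⟩
      left_inv := fun _ => rfl
      right_inv := fun _ => rfl }
  have h := hd k (α.filter fun i => b i = k) fun i hi => (Finset.mem_filter.1 hi).2
  rw [← Matrix.det_submatrix_equiv_self e] at h
  exact h

theorem IsBlockTriangularK.isPMatrix {n m : ℕ} {M : Matrix (Fin (n * m)) (Fin (n * m)) ℝ}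
    (hM : IsBlockTriangularK n m M) : IsPMatrix M := by
  let b : Fin (n * m) → Fin n := fun i => (finProdFinEquiv.symm i).1
  have hentry : ∀ i j, M i j = matrixBlock M (b i) (b j) (finProdFinEquiv.symm i).2
      (finProdFinEquiv.symm j).2 := fun i j => by
    simp only [matrixBlock, Matrix.of_apply, b, Prod.mk.eta, Equiv.apply_symm_apply]
  have hd : ∀ k : Fin n, IsKMatrix (matrixBlock M k k) → ∀ α : Finset (Fin (n * m)),
      (∀ i ∈ α, b i = k) →
      0 < (M.submatrix (fun i : α => (i : Fin (n * m))) (fun i : α => (i : Fin (n * m)))).det := by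
    intro k hk α hα
    have hinj : Function.Injective
        (fun i : α => (finProdFinEquiv.symm (i : Fin (n * m))).2) := fun i j hij =>
      Subtype.ext <| finProdFinEquiv.symm.injective <|
        Prod.ext ((hα i i.2).trans (hα j j.2).symm) hij
    have h := hk.2.det_submatrix_pos hinj
    convert h using 2
    ext i j
    rw [Matrix.submatrix_apply, Matrix.submatrix_apply, hentry, hα i i.2, hα j j.2]
  rcases hM with h | h
  -- `Matrix.BlockTriangular` means upper triangular, so the lower triangular case reverses the
  -- order of the blocks.
  · refine isPMatrix_of_blockTriangular (b := fun i => OrderDual.toDual (b i)) ?_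
      fun k => hd (OrderDual.ofDual k) ((h _ _).2 le_rfl)
    intro i j hij
    rw [hentry, (h _ _).1 (OrderDual.toDual_lt_toDual.1 hij)]
    rfl
  · refine isPMatrix_of_blockTriangular (b := b) ?_ fun k => hd k ((h _ _).2 le_rfl)
    intro i j hij
    rw [hentry, (h _ _).1 hij]
    rfl

/-! ### Lexicographically positive vectors -/

/-- The first nonzero entry exists and is positive. -/
def LexPos {k : ℕ} (x : Fin k → ℝ) : Prop :=
  ∃ i, (∀ j < i, x j = 0) ∧ 0 < x i

theorem toLex_lt_toLex_iff_lexPos {k : ℕ} {x y : Fin k → ℝ} :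
    toLex x < toLex y ↔ LexPos (y - x) := by
  change (∃ i, (∀ j < i, x j = y j) ∧ x i < y i) ↔ _
  simp only [LexPos, Pi.sub_apply, sub_eq_zero, sub_pos, eq_comm]

theorem LexPos.smul {k : ℕ} {x : Fin k → ℝ} (hx : LexPos x) {c : ℝ} (hc : 0 < c) :
    LexPos (c • x) := by
  obtain ⟨i, h0, hi⟩ := hx
  exact ⟨i, fun j hj => by simp [h0 j hj], by simpa using mul_pos hc hi⟩

theorem LexPos.add {k : ℕ} {x y : Fin k → ℝ} (hx : LexPos x) (hy : LexPos y) :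
    LexPos (x + y) := by
  obtain ⟨i, hi0, hi⟩ := hx
  obtain ⟨j, hj0, hj⟩ := hy
  rcases lt_trichotomy i j with h | rfl | h
  · exact ⟨i, fun l hl => by simp [hi0 l hl, hj0 l (hl.trans h)], by simp [hj0 i h, hi]⟩
  · exact ⟨i, fun l hl => by simp [hi0 l hl, hj0 l hl], add_pos hi hj⟩
  · exact ⟨j, fun l hl => by simp [hi0 l (hl.trans h), hj0 l hl], by simp [hi0 j h, hj]⟩

theorem LexPos.head_nonneg {k : ℕ} {x : Fin (k + 1) → ℝ} (hx : LexPos x) : 0 ≤ x 0 := by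
  obtain ⟨i, hi0, hi⟩ := hx
  rcases eq_or_ne i 0 with rfl | h
  · exact hi.le
  · exact (hi0 0 (Fin.pos_iff_ne_zero.2 h)).ge

theorem argminIn_eq_some {N : ℕ} {S : Finset (Fin N)} {key : Fin N → Lex (Fin (N + 1) → ℝ)}
    (hS : S.Nonempty) : ∃ r, argminIn S key = some r ∧ r ∈ S ∧ ∀ j ∈ S, key r ≤ key j :=
  ⟨_, by rw [argminIn, dif_pos hS], (S.exists_min_image key hS).choose_spec⟩

/-! ### Pivoting -/

theorem Matrix.updateCol_mulVec_eq {ι : Type*} [Fintype ι] [DecidableEq ι] (A : Matrix ι ι ℝ)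
    (r : ι) (a v : ι → ℝ) :
    (A.updateCol r a).mulVec v = A.mulVec v + v r • (a - A.mulVec (Pi.single r 1)) := by
  ext k
  have : ∀ j, A.updateCol r a k j * v j =
      A k j * v j + if j = r then v r * (a k - A k r) else 0 := by
    intro j
    rw [Matrix.updateCol_apply]
    split_ifs with h
    · subst h; ring
    · ring
  simp only [Matrix.mulVec, dotProduct, this, Finset.sum_add_distrib, Finset.sum_ite_eq',
    Finset.mem_univ, if_true, Pi.add_apply, Pi.smul_apply, Pi.sub_apply, smul_eq_mul]
  simp [Pi.single_apply]

/-- The effect of a pivot on the solution of `A x = y`: the new column is `a`, it replaces the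
column `r`, and the pivot entry does not vanish. -/
theorem Matrix.updateCol_inv_mulVec {ι : Type*} [Fintype ι] [DecidableEq ι] {A : Matrix ι ι ℝ}
    (hA : IsUnit A.det) {r : ι} {a : ι → ℝ} (hr : A⁻¹.mulVec a r ≠ 0) :
    IsUnit (A.updateCol r a).det ∧ ∀ y, (A.updateCol r a)⁻¹.mulVec y =
      A⁻¹.mulVec y - (A⁻¹.mulVec y r / A⁻¹.mulVec a r) • (A⁻¹.mulVec a - Pi.single r 1) := by
  have hsol : ∀ y, A.mulVec (A⁻¹.mulVec y) = y := fun y => by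
    rw [Matrix.mulVec_mulVec, Matrix.mul_nonsing_inv _ hA, Matrix.one_mulVec]
  have key : ∀ y, (A.updateCol r a).mulVec (A⁻¹.mulVec y -
      (A⁻¹.mulVec y r / A⁻¹.mulVec a r) • (A⁻¹.mulVec a - Pi.single r 1)) = y := by
    intro y
    rw [Matrix.updateCol_mulVec_eq, Matrix.mulVec_sub, Matrix.mulVec_smul, Matrix.mulVec_sub,
      hsol, hsol]
    have : (A⁻¹.mulVec y - (A⁻¹.mulVec y r / A⁻¹.mulVec a r) •
        (A⁻¹.mulVec a - Pi.single r 1) : ι → ℝ) r = A⁻¹.mulVec y r / A⁻¹.mulVec a r := by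
      simp only [Pi.sub_apply, Pi.smul_apply, Pi.single_eq_same, smul_eq_mul]
      field_simp
      ring
    rw [this]
    abel
  -- The explicit solutions in `key` make the new matrix surjective, hence invertible.
  have hu : IsUnit (A.updateCol r a).det := (Matrix.isUnit_iff_isUnit_det _).1
    (Matrix.mulVec_surjective_iff_isUnit.1 fun y => ⟨_, key y⟩)
  refine ⟨hu, fun y => ?_⟩
  conv_lhs => rw [← key y]
  rw [Matrix.mulVec_mulVec, Matrix.nonsing_inv_mul _ hu, Matrix.one_mulVec]

theorem lemkeBasisMatrix_update {N : ℕ} (M : Matrix (Fin N) (Fin N) ℝ) (d : Fin N → ℝ)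
    (B : Fin N → LemkeVar N) (r : Fin N) (e : LemkeVar N) :
    lemkeBasisMatrix M d (Function.update B r e) =
      (lemkeBasisMatrix M d B).updateCol r (lemkeColumn M d e) := by
  ext k j
  rw [Matrix.updateCol_apply]
  by_cases h : j = r
  · subst h; simp [lemkeBasisMatrix]
  · simp [lemkeBasisMatrix, h]

theorem lemkeBasisMatrix_mulVec_single {N : ℕ} (M : Matrix (Fin N) (Fin N) ℝ) (d : Fin N → ℝ)
    (B : Fin N → LemkeVar N) (r : Fin N) :
    (lemkeBasisMatrix M d B).mulVec (Pi.single r 1) = lemkeColumn M d (B r) := by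
  ext k
  simp [lemkeBasisMatrix]

theorem lemkeDrivingColumn_self {N : ℕ} {M : Matrix (Fin N) (Fin N) ℝ} {d : Fin N → ℝ}
    {B : Fin N → LemkeVar N} (hB : IsUnit (lemkeBasisMatrix M d B).det) (r : Fin N) :
    lemkeDrivingColumn M d B (B r) = Pi.single r 1 := by
  rw [lemkeDrivingColumn, ← lemkeBasisMatrix_mulVec_single, Matrix.mulVec_mulVec,
    Matrix.nonsing_inv_mul _ hB, Matrix.one_mulVec]

/-- Row `r` of `B⁻¹ [q, I]`. -/
noncomputable def lemkeRow {N : ℕ} (M : Matrix (Fin N) (Fin N) ℝ) (q d : Fin N → ℝ)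
    (B : Fin N → LemkeVar N) (r : Fin N) : Fin (N + 1) → ℝ :=
  Fin.cons (lemkeBasicValues M q d B r) ((lemkeBasisMatrix M d B)⁻¹ r)

/-- Each column of `B⁻¹ [q, I]` is `B⁻¹` applied to a fixed vector, so one pivot formula serves for
the values and for the inverse alike. -/
theorem lemkeRow_apply {N : ℕ} (M : Matrix (Fin N) (Fin N) ℝ) (q d : Fin N → ℝ)
    (B : Fin N → LemkeVar N) (r : Fin N) (k : Fin (N + 1)) :
    lemkeRow M q d B r k = (lemkeBasisMatrix M d B)⁻¹.mulVec
      ((Fin.cons q (fun i => Pi.single i 1) : Fin (N + 1) → Fin N → ℝ) k) r := by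
  refine Fin.cases ?_ (fun i => ?_) k
  · simp [lemkeRow, lemkeBasicValues]
  · simp [lemkeRow]

section Pivot

variable {N : ℕ} {M : Matrix (Fin N) (Fin N) ℝ} {q d : Fin N → ℝ} {B : Fin N → LemkeVar N}
  {r : Fin N} {e : LemkeVar N}

theorem isUnit_det_lemkeBasisMatrix_update (hB : IsUnit (lemkeBasisMatrix M d B).det)
    (hr : lemkeDrivingColumn M d B e r ≠ 0) :
    IsUnit (lemkeBasisMatrix M d (Function.update B r e)).det := by
  rw [lemkeBasisMatrix_update]
  exact (Matrix.updateCol_inv_mulVec hB hr).1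

theorem lemkeRow_update_self (hB : IsUnit (lemkeBasisMatrix M d B).det)
    (hr : lemkeDrivingColumn M d B e r ≠ 0) :
    lemkeRow M q d (Function.update B r e) r =
      (lemkeDrivingColumn M d B e r)⁻¹ • lemkeRow M q d B r := by
  ext k
  rw [Pi.smul_apply, lemkeRow_apply, lemkeRow_apply, lemkeBasisMatrix_update,
    (Matrix.updateCol_inv_mulVec hB hr).2]
  simp only [lemkeDrivingColumn] at hr ⊢
  simp only [Pi.sub_apply, Pi.smul_apply, Pi.single_eq_same, smul_eq_mul]
  field_simp
  ring

theorem lemkeRow_update_of_ne (hB : IsUnit (lemkeBasisMatrix M d B).det)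
    (hr : lemkeDrivingColumn M d B e r ≠ 0) {j : Fin N} (hj : j ≠ r) :
    lemkeRow M q d (Function.update B r e) j = lemkeRow M q d B j -
      (lemkeDrivingColumn M d B e j / lemkeDrivingColumn M d B e r) • lemkeRow M q d B r := by
  ext k
  rw [Pi.sub_apply, Pi.smul_apply, lemkeRow_apply, lemkeRow_apply, lemkeRow_apply,
    lemkeBasisMatrix_update, (Matrix.updateCol_inv_mulVec hB hr).2]
  simp only [lemkeDrivingColumn, Pi.sub_apply, Pi.smul_apply, Pi.single_eq_of_ne hj, smul_eq_mul]
  ring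

/-- In the new basis, the column of the variable that has just left. -/
theorem lemkeDrivingColumn_update_of_ne (hB : IsUnit (lemkeBasisMatrix M d B).det)
    (hr : lemkeDrivingColumn M d B e r ≠ 0) {j : Fin N} (hj : j ≠ r) :
    lemkeDrivingColumn M d (Function.update B r e) (B r) j =
      -(lemkeDrivingColumn M d B e j / lemkeDrivingColumn M d B e r) := by
  have h := lemkeDrivingColumn_self hB r
  rw [lemkeDrivingColumn] at h
  rw [lemkeDrivingColumn, lemkeBasisMatrix_update, (Matrix.updateCol_inv_mulVec hB hr).2, h]
  simp only [lemkeDrivingColumn, Pi.sub_apply, Pi.smul_apply, Pi.single_eq_of_ne hj,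
    Pi.single_eq_same, smul_eq_mul]
  ring

theorem lemkeDrivingColumn_update_self (hB : IsUnit (lemkeBasisMatrix M d B).det)
    (hr : lemkeDrivingColumn M d B e r ≠ 0) :
    lemkeDrivingColumn M d (Function.update B r e) (B r) r =
      (lemkeDrivingColumn M d B e r)⁻¹ := by
  have h := lemkeDrivingColumn_self hB r
  rw [lemkeDrivingColumn] at h
  rw [lemkeDrivingColumn, lemkeBasisMatrix_update, (Matrix.updateCol_inv_mulVec hB hr).2, h]
  simp only [lemkeDrivingColumn] at hr ⊢
  simp only [Pi.sub_apply, Pi.smul_apply, Pi.single_eq_same, smul_eq_mul]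
  field_simp
  ring

/-- Different rows of `B⁻¹ [q, I]` are not proportional. -/
theorem lexRatio_ne (hB : IsUnit (lemkeBasisMatrix M d B).det) {i j : Fin N} (hij : i ≠ j)
    {a b : ℝ} (ha : a ≠ 0) :
    lexRatio (lemkeBasicValues M q d B i) ((lemkeBasisMatrix M d B)⁻¹ i) a ≠
      lexRatio (lemkeBasicValues M q d B j) ((lemkeBasisMatrix M d B)⁻¹ j) b := by
  intro h
  -- The `B⁻¹` parts alone suffice: multiplied by the basis matrix, proportional rows would give
  -- proportional unit vectors.
  have hrow : ∀ k, (lemkeBasisMatrix M d B)⁻¹ i k / a = (lemkeBasisMatrix M d B)⁻¹ j k / b :=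
    fun k => congrFun (toLex_inj.1 h) k.succ
  have h₁ : ((lemkeBasisMatrix M d B)⁻¹ * lemkeBasisMatrix M d B) i i / a =
      ((lemkeBasisMatrix M d B)⁻¹ * lemkeBasisMatrix M d B) j i / b := by
    simp only [Matrix.mul_apply, Finset.sum_div, ← div_mul_eq_mul_div, hrow]
  rw [Matrix.nonsing_inv_mul _ hB, Matrix.one_apply_eq, Matrix.one_apply_ne hij.symm] at h₁
  simp [ha] at h₁

end Pivot

theorem toLex_lemkeRow_div {N : ℕ} (M : Matrix (Fin N) (Fin N) ℝ) (q d : Fin N → ℝ)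
    (B : Fin N → LemkeVar N) (r : Fin N) (c : ℝ) :
    lexRatio (lemkeBasicValues M q d B r) ((lemkeBasisMatrix M d B)⁻¹ r) c =
      toLex (c⁻¹ • lemkeRow M q d B r) := by
  refine congrArg toLex (funext fun k => ?_)
  rw [Pi.smul_apply, smul_eq_mul, inv_mul_eq_div]
  rfl

/-! ### Complementary bases -/

/-- `B` contains exactly one variable of each pair `w i, z i`; `σ r` is the index of `B r`. -/
structure IsComplementaryBasis {N : ℕ} (B : Fin N → LemkeVar N) (σ : Fin N → Fin N) : Prop where
  injective : Function.Injective σ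
  eq_or_eq : ∀ r, B r = .w (σ r) ∨ B r = .z (σ r)

theorem IsComplementaryBasis.surjective {N : ℕ} {B : Fin N → LemkeVar N} {σ : Fin N → Fin N}
    (h : IsComplementaryBasis B σ) : Function.Surjective σ :=
  Finite.surjective_of_injective h.injective

/-- The values of the variables `v i`, where the basic variables have the values `x`. -/
noncomputable def lemkePart {N : ℕ} (v : Fin N → LemkeVar N) (B : Fin N → LemkeVar N)
    (x : Fin N → ℝ) : Fin N → ℝ :=
  fun i => ∑ r, if B r = v i then x r else 0

theorem IsComplementaryBasis.lemkePart_w {N : ℕ} {B : Fin N → LemkeVar N} {σ : Fin N → Fin N}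
    (h : IsComplementaryBasis B σ) (x : Fin N → ℝ) (r : Fin N) :
    lemkePart .w B x (σ r) = if B r = .w (σ r) then x r else 0 := by
  rw [lemkePart, Finset.sum_eq_single r]
  · intro s _ hs
    have := h.injective.ne hs
    rcases h.eq_or_eq s with h' | h' <;> simp [h', this]
  · simp

theorem IsComplementaryBasis.lemkePart_z {N : ℕ} {B : Fin N → LemkeVar N} {σ : Fin N → Fin N}
    (h : IsComplementaryBasis B σ) (x : Fin N → ℝ) (r : Fin N) :
    lemkePart .z B x (σ r) = if B r = .z (σ r) then x r else 0 := by
  rw [lemkePart, Finset.sum_eq_single r]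
  · intro s _ hs
    have := h.injective.ne hs
    rcases h.eq_or_eq s with h' | h' <;> simp [h', this]
  · simp

theorem IsComplementaryBasis.lemkePart_mul {N : ℕ} {B : Fin N → LemkeVar N} {σ : Fin N → Fin N}
    (h : IsComplementaryBasis B σ) (x : Fin N → ℝ) (i : Fin N) :
    lemkePart .z B x i * lemkePart .w B x i = 0 := by
  obtain ⟨r, rfl⟩ := h.surjective i
  rw [h.lemkePart_w, h.lemkePart_z]
  rcases h.eq_or_eq r with h' | h' <;> simp [h']

/-- Translates between the tableau and the equation `w - M z = q`: the columns are regrouped by the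
index `σ r`. -/
theorem IsComplementaryBasis.mulVec {N : ℕ} {M : Matrix (Fin N) (Fin N) ℝ} {d : Fin N → ℝ}
    {B : Fin N → LemkeVar N} {σ : Fin N → Fin N} (h : IsComplementaryBasis B σ)
    (x : Fin N → ℝ) : (lemkeBasisMatrix M d B).mulVec x =
      lemkePart .w B x - M.mulVec (lemkePart .z B x) := by
  ext k
  have hw : lemkePart .w B x k = ∑ r, if B r = .w k then x r else 0 := rfl
  have hz : M.mulVec (lemkePart .z B x) k =
      ∑ r, M k (σ r) * if B r = .z (σ r) then x r else 0 := by
    refine (Function.Bijective.sum_comp ⟨h.injective, h.surjective⟩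
      (fun i => M k i * lemkePart .z B x i)).symm.trans (Finset.sum_congr rfl fun r _ => ?_)
    rw [h.lemkePart_z]
  rw [Pi.sub_apply, hw, hz, ← Finset.sum_sub_distrib]
  change ∑ r, lemkeBasisMatrix M d B k r * x r = _
  refine Finset.sum_congr rfl fun r _ => ?_
  rcases h.eq_or_eq r with h' | h'
  · by_cases hk : σ r = k
    · simp [lemkeBasisMatrix, lemkeColumn, h', hk]
    · simp [lemkeBasisMatrix, lemkeColumn, h', hk, Ne.symm hk]
  · simp [lemkeBasisMatrix, lemkeColumn, h']

/-- A complementary basis with nonnegative values of the basic variables yields a solution. -/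
theorem IsComplementaryBasis.lemkeZPart_mem {N : ℕ} {M : Matrix (Fin N) (Fin N) ℝ}
    {q d : Fin N → ℝ} {B : Fin N → LemkeVar N} {σ : Fin N → Fin N}
    (h : IsComplementaryBasis B σ) (hB : IsUnit (lemkeBasisMatrix M d B).det)
    (hx : ∀ r, 0 ≤ lemkeBasicValues M q d B r) : lemkeZPart M q d B ∈ lcpSolutions M q := by
  have hz : lemkeZPart M q d B = lemkePart .z B (lemkeBasicValues M q d B) := rfl
  have hpos : ∀ v : Fin N → LemkeVar N, 0 ≤ lemkePart v B (lemkeBasicValues M q d B) :=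
    fun v i => Finset.sum_nonneg fun r _ => by
      split_ifs
      exacts [hx r, le_rfl]
  have hq := h.mulVec (M := M) (d := d) (lemkeBasicValues M q d B)
  rw [lemkeBasicValues, Matrix.mulVec_mulVec, Matrix.mul_nonsing_inv _ hB, Matrix.one_mulVec,
    ← lemkeBasicValues] at hq
  have hw : q + M.mulVec (lemkePart .z B (lemkeBasicValues M q d B)) =
      lemkePart .w B (lemkeBasicValues M q d B) := by
    conv_lhs => enter [1]; rw [hq]
    exact sub_add_cancel _ _
  rw [hz]
  refine ⟨⟨hpos _, ?_⟩, ?_⟩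
  · rw [hw]; exact hpos _
  · rw [hw]; exact Finset.sum_eq_zero fun i _ => h.lemkePart_mul _ i

/-- In a linear dependence between a complementary basis and one further variable `z i`, whose
complement is basic, the coefficients of `w i` and `z i` have the same sign. -/
theorem IsPMatrix.mul_pos_of_dependence {N : ℕ} {M : Matrix (Fin N) (Fin N) ℝ}
    (hM : IsPMatrix M) {d : Fin N → ℝ} {B : Fin N → LemkeVar N} {σ : Fin N → Fin N}
    (h : IsComplementaryBasis B σ) {p : Fin N} (hp : B p = .w (σ p)) {x : Fin N → ℝ} {β : ℝ}
    (hne : x p ≠ 0 ∨ β ≠ 0)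
    (hx : (lemkeBasisMatrix M d B).mulVec x + β • lemkeColumn M d (.z (σ p)) = 0) :
    0 < x p * β := by
  set W := lemkePart .w B x with hW
  set Z := lemkePart .z B x + β • Pi.single (σ p) (1 : ℝ) with hZ
  have hWZ : W = M.mulVec Z := by
    have hcol : lemkeColumn M d (.z (σ p)) = -M.mulVec (Pi.single (σ p) 1) := by
      ext k
      simp [lemkeColumn]
    rw [h.mulVec, hcol] at hx
    rw [hZ, Matrix.mulVec_add, Matrix.mulVec_smul, ← sub_eq_zero, ← hx, smul_neg]
    abel
  have hWp : W (σ p) = x p := by rw [hW, h.lemkePart_w, if_pos hp]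
  have hZp : Z (σ p) = β := by simp [hZ, h.lemkePart_z, hp]
  -- Away from `σ p` the pairs stay complementary, so the index at which `Z` and `M Z` have a
  -- positive product can only be `σ p`.
  have hprod : ∀ k, k ≠ σ p → Z k * W k = 0 := fun k hk => by
    have : Z k = lemkePart .z B x k := by simp [hZ, hk]
    rw [this, hW, h.lemkePart_mul]
  have hZ0 : Z ≠ 0 := by
    intro h0
    rw [h0, Matrix.mulVec_zero] at hWZ
    rw [h0] at hZp
    rw [hWZ] at hWp
    exact hne.elim (fun h => h hWp.symm) (fun h => h hZp.symm)
  obtain ⟨k, hk⟩ := hM.exists_mul_mulVec_pos hZ0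
  rw [← hWZ] at hk
  have hkp : k = σ p := by
    by_contra hkp
    exact hk.ne' (hprod k hkp)
  rw [hkp, hZp, hWp] at hk
  rwa [mul_comm]

/-- The entries of the columns of `w i` and `z i` in the row of the artificial variable have
opposite signs. -/
theorem IsPMatrix.lemkeDrivingColumn_mul_neg {N : ℕ} {M : Matrix (Fin N) (Fin N) ℝ}
    (hM : IsPMatrix M) {d : Fin N → ℝ} {B : Fin N → LemkeVar N} {σ : Fin N → Fin N}
    {p : Fin N} (hB : IsUnit (lemkeBasisMatrix M d B).det)
    (h : IsComplementaryBasis (Function.update B p (.w (σ p))) σ)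
    (hne : lemkeDrivingColumn M d B (.w (σ p)) p ≠ 0 ∨
      lemkeDrivingColumn M d B (.z (σ p)) p ≠ 0) :
    lemkeDrivingColumn M d B (.w (σ p)) p * lemkeDrivingColumn M d B (.z (σ p)) p < 0 := by
  set u := lemkeDrivingColumn M d B (.w (σ p)) with hu
  set v := lemkeDrivingColumn M d B (.z (σ p)) with hv
  have hsol : ∀ e, (lemkeBasisMatrix M d B).mulVec (lemkeDrivingColumn M d B e) =
      lemkeColumn M d e := fun e => by
    rw [lemkeDrivingColumn, Matrix.mulVec_mulVec, Matrix.mul_nonsing_inv _ hB, Matrix.one_mulVec]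
  -- The combination `u p • v - v p • u` eliminates the variable `B p`. Slot `p` then receives the
  -- coefficient `v p` of `w (σ p)`, which has taken its place; the coefficient of `z (σ p)` is `-u
  -- p`.
  set x : Fin N → ℝ := u p • v - v p • u + v p • Pi.single p 1 with hx
  have hxp : x p = v p := by
    simp only [hx, Pi.add_apply, Pi.sub_apply, Pi.smul_apply, Pi.single_eq_same, smul_eq_mul]
    ring
  have := hM.mul_pos_of_dependence (d := d) h (p := p) (x := x) (β := -u p) (by simp)
    (by rw [hxp, neg_ne_zero]; exact hne.symm) (by
      rw [lemkeBasisMatrix_update, Matrix.updateCol_mulVec_eq, hxp, hx, Matrix.mulVec_add,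
        Matrix.mulVec_sub, Matrix.mulVec_smul, Matrix.mulVec_smul, Matrix.mulVec_smul,
        hu, hv, hsol, hsol, smul_sub, neg_smul]
      abel)
  rw [hxp] at this
  linarith

/-! ### Lemke's algorithm for `P`-matrices -/

instance LemkeVar.instFinite (N : ℕ) : Finite (LemkeVar N) :=
  Finite.of_surjective
    (fun s : Fin N ⊕ Fin N ⊕ Unit =>
      Sum.elim LemkeVar.w (Sum.elim LemkeVar.z fun _ => LemkeVar.z0) s)
    fun v => match v with
      | .w i => ⟨.inl i, rfl⟩
      | .z i => ⟨.inr (.inl i), rfl⟩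
      | .z0 => ⟨.inr (.inr ()), rfl⟩

/-- The states that Lemke's algorithm passes through: the artificial variable is basic in row `p`,
the basis is almost complementary and lexicographically feasible, and the artificial variable
decreases when the driving variable `e` is raised. -/
structure IsLemkeState {N : ℕ} (M : Matrix (Fin N) (Fin N) ℝ) (q d : Fin N → ℝ)
    (B : Fin N → LemkeVar N) (e : LemkeVar N) (p : Fin N) (σ : Fin N → Fin N) : Prop where
  isUnit : IsUnit (lemkeBasisMatrix M d B).det
  basic_z0 : B p = .z0
  complementary : IsComplementaryBasis (Function.update B p e) σ
  lexPos : ∀ r, LexPos (lemkeRow M q d B r)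
  drive_pos : 0 < lemkeDrivingColumn M d B e p

section

variable {N : ℕ} {M : Matrix (Fin N) (Fin N) ℝ} {q d : Fin N → ℝ} {B : Fin N → LemkeVar N}
  {e : LemkeVar N} {p : Fin N} {σ : Fin N → Fin N}

theorem IsComplementaryBasis.update {C : Fin N → LemkeVar N} (h : IsComplementaryBasis C σ)
    {v : LemkeVar N} {r : Fin N} (hv : v = .w (σ r) ∨ v = .z (σ r)) :
    IsComplementaryBasis (Function.update C r v) σ := by
  refine ⟨h.injective, fun s => ?_⟩
  by_cases hs : s = r
  · subst hs; simpa using hv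
  · simpa [hs] using h.eq_or_eq s

/-- The lexicographic minimum ratio test preserves lexicographic feasibility. -/
theorem lexPos_lemkeRow_update (hB : IsUnit (lemkeBasisMatrix M d B).det)
    (hpos : ∀ r, LexPos (lemkeRow M q d B r)) {r : Fin N}
    (hr : 0 < lemkeDrivingColumn M d B e r)
    (hmin : ∀ j, 0 < lemkeDrivingColumn M d B e j →
      lexRatio (lemkeBasicValues M q d B r) ((lemkeBasisMatrix M d B)⁻¹ r)
        (lemkeDrivingColumn M d B e r) ≤
      lexRatio (lemkeBasicValues M q d B j) ((lemkeBasisMatrix M d B)⁻¹ j)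
        (lemkeDrivingColumn M d B e j)) (j : Fin N) :
    LexPos (lemkeRow M q d (Function.update B r e) j) := by
  rcases eq_or_ne j r with rfl | hj
  · rw [lemkeRow_update_self hB hr.ne']
    exact (hpos j).smul (inv_pos.2 hr)
  rw [lemkeRow_update_of_ne hB hr.ne' hj]
  rcases lt_trichotomy (lemkeDrivingColumn M d B e j) 0 with hc | hc | hc
  · rw [sub_eq_add_neg, ← neg_smul]
    exact (hpos j).add ((hpos r).smul (neg_pos.2 (div_neg_of_neg_of_pos hc hr)))
  · simpa [hc] using hpos j
  -- Only here can a row lose positivity. Ties are impossible, so the minimum is strict and the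
  -- difference of the scaled rows is lexicographically positive.
  · have hlt := lt_of_le_of_ne (hmin j hc) (lexRatio_ne hB hj.symm hr.ne')
    rw [toLex_lemkeRow_div, toLex_lemkeRow_div] at hlt
    have := (toLex_lt_toLex_iff_lexPos.1 hlt).smul hc
    rwa [smul_sub, smul_smul, smul_smul, mul_inv_cancel₀ hc.ne', one_smul,
      ← div_eq_mul_inv] at this

/-- The blocking variable has left, and its complement `e'` becomes the driving variable. -/
theorem IsLemkeState.update (hM : IsPMatrix M) (h : IsLemkeState M q d B e p σ) {r : Fin N}
    (hr : 0 < lemkeDrivingColumn M d B e r)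
    (hmin : ∀ j, 0 < lemkeDrivingColumn M d B e j →
      lexRatio (lemkeBasicValues M q d B r) ((lemkeBasisMatrix M d B)⁻¹ r)
        (lemkeDrivingColumn M d B e r) ≤
      lexRatio (lemkeBasicValues M q d B j) ((lemkeBasisMatrix M d B)⁻¹ j)
        (lemkeDrivingColumn M d B e j))
    (hrp : r ≠ p) {e' : LemkeVar N} {i : Fin N}
    (he' : B r = .w i ∧ e' = .z i ∨ B r = .z i ∧ e' = .w i) :
    (∃ τ, IsLemkeState M q d (Function.update B r e) e' p τ) ∧
      toLex (lemkeRow M q d (Function.update B r e) p) < toLex (lemkeRow M q d B p) := by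
  have hu := isUnit_det_lemkeBasisMatrix_update h.isUnit hr.ne'
  have hi : i = σ r := by
    have := h.complementary.eq_or_eq r
    rw [Function.update_of_ne hrp] at this
    rcases he' with ⟨h1, -⟩ | ⟨h1, -⟩ <;> simpa [h1] using this
  -- The old driving variable, of index `σ p`, now sits in row `r`, and the index of the pair whose
  -- members are both nonbasic moves to row `p`.
  set τ : Fin N → Fin N := σ ∘ Equiv.swap p r with hτ
  have hτp : τ p = i := by simp [hτ, hi]
  have hcomp : ∀ v, v = .w i ∨ v = .z i →
      IsComplementaryBasis (Function.update (Function.update B r e) p v) τ := by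
    intro v hv
    refine ⟨h.complementary.injective.comp (Equiv.injective _), fun s => ?_⟩
    by_cases hsp : s = p
    · subst hsp; simpa [hτp] using hv
    by_cases hsr : s = r
    · subst hsr
      simpa [hsp, hτ] using h.complementary.eq_or_eq p
    · simpa [hsp, hsr, hτ, Equiv.swap_apply_of_ne_of_ne hsp hsr]
        using h.complementary.eq_or_eq s
  have hleft := lemkeDrivingColumn_update_of_ne h.isUnit hr.ne' (r := r) hrp.symm
  -- Undoing the pivot would raise `z₀`; by the opposite signs, raising the complement lowers it.
  have hneg : lemkeDrivingColumn M d (Function.update B r e) (B r) p < 0 := by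
    rw [hleft]
    exact neg_neg_of_pos (div_pos h.drive_pos hr)
  have hsign := hM.lemkeDrivingColumn_mul_neg (σ := τ) (p := p) hu (hcomp _ (by simp [hτp]))
  rw [hτp] at hsign
  refine ⟨⟨τ, hu, by rw [Function.update_of_ne hrp.symm, h.basic_z0], hcomp _ ?_,
    lexPos_lemkeRow_update h.isUnit h.lexPos hr hmin, ?_⟩, ?_⟩
  · rcases he' with ⟨-, h1⟩ | ⟨-, h1⟩ <;> simp [h1]
  · rcases he' with ⟨h1, rfl⟩ | ⟨h1, rfl⟩
    · rw [h1] at hneg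
      exact pos_of_mul_neg_right (hsign (.inl hneg.ne)) hneg.le
    · rw [h1] at hneg
      exact pos_of_mul_neg_left (hsign (.inr hneg.ne)) hneg.le
  -- The `z₀`-row loses a positive multiple of the lexicographically positive row `r`, so it
  -- decreases even in a degenerate pivot.
  · rw [toLex_lt_toLex_iff_lexPos, lemkeRow_update_of_ne h.isUnit hr.ne' hrp.symm, sub_sub_cancel]
    exact (h.lexPos r).smul (div_pos h.drive_pos hr)

/-- By `drive_pos` the row `p` is itself a candidate in the ratio test, which rules out a ray. If
row `p` wins, the driving variable replaces `z₀` and the basis becomes complementary. -/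
theorem IsLemkeState.step (hM : IsPMatrix M) (h : IsLemkeState M q d B e p σ) :
    (∃ z, lemkeStep M q d (.pivoting B e) = .stopped z ∧ z ∈ lcpSolutions M q) ∨
    ∃ B' e' τ, lemkeStep M q d (.pivoting B e) = .pivoting B' e' ∧
      IsLemkeState M q d B' e' p τ ∧
      toLex (lemkeRow M q d B' p) < toLex (lemkeRow M q d B p) := by
  obtain ⟨r, hrow, hr, hmin⟩ : ∃ r, lemkeBlockingRow M q d B e = some r ∧
      0 < lemkeDrivingColumn M d B e r ∧ ∀ j, 0 < lemkeDrivingColumn M d B e j →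
      lexRatio (lemkeBasicValues M q d B r) ((lemkeBasisMatrix M d B)⁻¹ r)
        (lemkeDrivingColumn M d B e r) ≤
      lexRatio (lemkeBasicValues M q d B j) ((lemkeBasisMatrix M d B)⁻¹ j)
        (lemkeDrivingColumn M d B e j) := by
    classical
    obtain ⟨r, h1, h2, h3⟩ := argminIn_eq_some
      (S := Finset.univ.filter fun r => 0 < lemkeDrivingColumn M d B e r)
      (key := fun r => lexRatio (lemkeBasicValues M q d B r) ((lemkeBasisMatrix M d B)⁻¹ r)
        (lemkeDrivingColumn M d B e r)) ⟨p, by simpa using h.drive_pos⟩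
    refine ⟨r, ?_, by simpa using h2, fun j hj => h3 j (by simpa using hj)⟩
    rw [← h1, lemkeBlockingRow]
  by_cases hrp : r = p
  · subst hrp
    left
    refine ⟨lemkeZPart M q d (Function.update B r e), by simp [lemkeStep, hrow, h.basic_z0], ?_⟩
    refine h.complementary.lemkeZPart_mem
      (isUnit_det_lemkeBasisMatrix_update h.isUnit hr.ne') fun j => ?_
    exact (lexPos_lemkeRow_update h.isUnit h.lexPos hr hmin j).head_nonneg
  · right
    have := h.complementary.eq_or_eq r
    rw [Function.update_of_ne hrp] at this
    rcases this with h1 | h1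
    · obtain ⟨⟨τ, hτ⟩, hlt⟩ := h.update hM hr hmin hrp (e' := .z (σ r)) (.inl ⟨h1, rfl⟩)
      exact ⟨_, _, τ, by simp [lemkeStep, hrow, h1], hτ, hlt⟩
    · obtain ⟨⟨τ, hτ⟩, hlt⟩ := h.update hM hr hmin hrp (e' := .w (σ r)) (.inr ⟨h1, rfl⟩)
      exact ⟨_, _, τ, by simp [lemkeStep, hrow, h1], hτ, hlt⟩

/-- The `z₀`-row depends only on the basis, and a strict order on the finite set of bases is
well-founded. -/
theorem IsLemkeState.exists_iterate (hM : IsPMatrix M) (h : IsLemkeState M q d B e p σ) :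
    ∃ k z, (lemkeStep M q d)^[k] (.pivoting B e) = .stopped z ∧ z ∈ lcpSolutions M q := by
  let key : (Fin N → LemkeVar N) → Lex (Fin (N + 1) → ℝ) := fun B => toLex (lemkeRow M q d B p)
  have : IsTrans (Fin N → LemkeVar N) (fun B C => key B < key C) :=
    ⟨fun _ _ _ => lt_trans⟩
  have : Std.Irrefl (fun B C : Fin N → LemkeVar N => key B < key C) :=
    ⟨fun _ => lt_irrefl _⟩
  have hwf := Finite.wellFounded_of_trans_of_irrefl
    (fun B C : Fin N → LemkeVar N => key B < key C)
  induction B using hwf.induction generalizing e σ with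
  | _ B ih =>
    rcases h.step hM with ⟨z, hz, hsol⟩ | ⟨B', e', τ, hstep, h', hlt⟩
    · exact ⟨1, z, hz, hsol⟩
    · obtain ⟨k, z, hk, hsol⟩ := ih B' hlt h'
      exact ⟨k + 1, z, by rw [Function.iterate_succ_apply, hstep, hk], hsol⟩

/-- Initialization yields a solution or an admissible state. -/
theorem lemkeInit_spec (hM : IsPMatrix M) (hd : ∀ i, 0 < d i) :
    (lemkeInit q d = .stopped 0 ∧ (0 : Fin N → ℝ) ∈ lcpSolutions M q) ∨
    ∃ B e p σ, lemkeInit q d = .pivoting B e ∧ IsLemkeState M q d B e p σ := by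
  by_cases hq : 0 ≤ q
  · exact .inl ⟨by simp [lemkeInit, hq], ⟨le_rfl, by simpa using hq⟩, by simp⟩
  right
  obtain ⟨i₀, hi₀⟩ : ∃ i, q i < 0 := by simpa [Pi.le_def] using hq
  obtain ⟨r, hrow, -, hmin⟩ := argminIn_eq_some (S := Finset.univ)
    (key := fun i => lexRatio (q i) (Pi.single i 1) (d i)) ⟨i₀, Finset.mem_univ _⟩
  have h1 : lemkeBasisMatrix M d .w = 1 := by
    ext i j
    simp [lemkeBasisMatrix, lemkeColumn, Matrix.one_apply, Pi.single_apply]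
  have hu : IsUnit (lemkeBasisMatrix M d .w).det := by simp [h1]
  have hcol : lemkeDrivingColumn M d .w .z0 = -d := by simp [lemkeDrivingColumn, h1, lemkeColumn]
  have hne : lemkeDrivingColumn M d .w .z0 r ≠ 0 := by simpa [hcol] using (hd r).ne'
  have hkey : ∀ i, lexRatio (q i) (Pi.single i 1) (d i) =
      toLex ((d i)⁻¹ • lemkeRow M q d .w i) := fun i => by
    rw [← toLex_lemkeRow_div]
    congr 1
    · simp [lemkeBasicValues, h1]
    · ext j
      simp [h1, Matrix.one_apply, Pi.single_apply, eq_comm]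
  have hrow0 : ∀ i, lemkeRow M q d .w i 0 = q i := fun i => by
    simp [lemkeRow, lemkeBasicValues, h1]
  -- The least ratio is at most that of `i₀`, which starts with a negative number; hence `q r < 0`.
  have hrneg : LexPos (-lemkeRow M q d .w r) := by
    have hle := hmin i₀ (Finset.mem_univ _)
    simp only [hkey] at hle
    have hr0 : q r < 0 := by
      rcases hle.eq_or_lt with heq | hlt
      · have := congrFun (toLex_inj.1 heq) 0
        simp only [Pi.smul_apply, hrow0, smul_eq_mul] at this
        have h2 := mul_neg_of_pos_of_neg (inv_pos.2 (hd i₀)) hi₀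
        rw [← this] at h2
        exact neg_of_mul_neg_right h2 (inv_pos.2 (hd r)).le
      · have := (toLex_lt_toLex_iff_lexPos.1 hlt).head_nonneg
        simp only [Pi.sub_apply, Pi.smul_apply, hrow0, smul_eq_mul] at this
        have h2 := mul_neg_of_pos_of_neg (inv_pos.2 (hd i₀)) hi₀
        exact neg_of_mul_neg_right (by linarith) (inv_pos.2 (hd r)).le
    exact ⟨0, fun j hj => absurd hj (Fin.not_lt_zero j), by simpa [hrow0] using hr0⟩
  -- The first pivot entry is `-d r`, so the column of `w r` gets the entry `-1 / d r` in the row of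
  -- `z₀`, and that of `z r` a positive one.
  have hleave : lemkeDrivingColumn M d (Function.update .w r .z0) (.w r) r < 0 := by
    have := lemkeDrivingColumn_update_self hu hne
    rw [this, hcol]
    simpa using hd r
  have hcomp : ∀ v, v = .w r ∨ v = .z r →
      IsComplementaryBasis (Function.update (Function.update .w r .z0) r v) id := fun v hv => by
    rw [Function.update_idem]
    exact IsComplementaryBasis.update ⟨Function.injective_id, fun _ => .inl rfl⟩ hv
  have hu' := isUnit_det_lemkeBasisMatrix_update hu hne
  refine ⟨_, _, r, id, by simp [lemkeInit, hq, hrow], hu', by simp,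
    hcomp _ (.inr rfl), fun j => ?_, ?_⟩
  · rcases eq_or_ne j r with rfl | hj
    · rw [lemkeRow_update_self hu hne, hcol, Pi.neg_apply, inv_neg, neg_smul, ← smul_neg]
      exact hrneg.smul (inv_pos.2 (hd j))
    -- The new row is row `j` minus `d j / d r` times row `r`, positive because `r` has the strictly
    -- least ratio.
    · rw [lemkeRow_update_of_ne hu hne hj, hcol, Pi.neg_apply, Pi.neg_apply, neg_div_neg_eq]
      have hneq : lexRatio (q r) (Pi.single r 1) (d r) ≠ lexRatio (q j) (Pi.single j 1) (d j) := by
        rw [hkey, hkey, ← toLex_lemkeRow_div, ← toLex_lemkeRow_div]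
        exact lexRatio_ne hu hj.symm (hd r).ne'
      have hlt := lt_of_le_of_ne (hmin j (Finset.mem_univ _)) hneq
      rw [hkey, hkey] at hlt
      have := (toLex_lt_toLex_iff_lexPos.1 hlt).smul (hd j)
      rwa [smul_sub, smul_smul, smul_smul, mul_inv_cancel₀ (hd j).ne', one_smul,
        ← div_eq_mul_inv] at this
  · exact pos_of_mul_neg_right (hM.lemkeDrivingColumn_mul_neg (σ := id) (p := r) hu'
      (hcomp _ (.inl rfl)) (.inl hleave.ne)) hleave.le

end

theorem IsPMatrix.isLemkeProcessable {N : ℕ} {M : Matrix (Fin N) (Fin N) ℝ} (hM : IsPMatrix M)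
    (q : Fin N → ℝ) : IsLemkeProcessable M q := by
  intro d hd
  rcases lemkeInit_spec (q := q) hM hd with ⟨h, hsol⟩ | ⟨B, e, p, σ, h, hs⟩
  · exact ⟨0, .inl ⟨0, h, hsol⟩⟩
  · obtain ⟨k, z, hk, hsol⟩ := hs.exists_iterate hM
    exact ⟨k, .inl ⟨z, by rw [h, hk], hsol⟩⟩

theorem mainTheorem4 (n m : ℕ) (M : Matrix (Fin (n * m)) (Fin (n * m)) ℝ)
    (hM : IsBlockTriangularK n m M) :
    IsPMatrix M ∧ ∀ q : Fin (n * m) → ℝ, IsLemkeProcessable M q :=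
  ⟨hM.isPMatrix, hM.isPMatrix.isLemkeProcessable⟩
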